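/- Let $\mathbf p=(p_k)_{k\ge 0}$ be a probability mass function on $\{0,1,2,\dots\}$ with $\sum_k k\,p_k<\infty$, $p_0\in(0,1)$, $p_0+p_1<1$ and $\gcd\{j: p_j>0\}=1$. Let $f(s)=\sum_{k\ge0}p_ks^k$, let $s_0$ be the unique positive root of $sf'(s)=f(s)$ if it exists and the radius of convergence of $f$ otherwise, and let $R=\lim_{s\uparrow s_0}s/f(s)$; this limit exists and $R\in(0,\infty)$. Let $A=(A_{ij})_{i,j\ge0}$ be the infinite matrix with $A_{ij}=p_{j-i+1}$ if $i\ge1$ and $j\ge i-1$, and $A_{ij}=0$ otherwise, and for $k\ge1$ let $A_k=(A_{ij})_{1\le i,j\le k}$. Let $\alpha_k$ be the largest real eigenvalue of $A_k$. Then $\alpha_k$ is the Perron–Frobenius eigenvalue of $A_k$, that is, it exists and every complex eigenvalue of $A_k$ has modulus at most $\alpha_k$; it is positive for all $k\ge k_0:=\inf\{k\ge1:p_k>0\}$; and $$\alpha_k\uparrow \frac1R\qquad\text{as }k\to\infty,$$ i.e. $(\alpha_k)_{k\ge1}$ is nondecreasing and converges to $1/R$. This holds although $A$ is not compact: for every $q\in[1,\infty]$,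 the matrix $A$ acts, by $(Ax)_i=\sum_{j}A_{ij}x_j$, as a bounded linear operator on the real sequence space $\ell^q(\{0,1,2,\dots\})$, and this operator is not compact. -/

import Mathlib

open Filter Topology
open scoped ENNReal

noncomputable section

/-- The probability generating function `f(s) = ∑ₖ pₖ sᵏ`. -/
def pgf (p : ℕ → ℝ) (s : ℝ) : ℝ := ∑' k : ℕ, p k * s ^ k

/-- The radius of convergence `r_f ∈ [0, ∞]` of the power series `∑ₖ pₖ sᵏ`. -/
def pgfRadius (p : ℕ → ℝ) : ℝ≥0∞ := (FormalMultilinearSeries.ofScalars ℝ p).radius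

/-- `s` is a positive root of `s f'(s) = f(s)` (inside the disc of convergence, where `f` is
differentiable). -/
def IsCriticalRoot (p : ℕ → ℝ) (s : ℝ) : Prop :=
  0 < s ∧ ENNReal.ofReal s < pgfRadius p ∧ s * deriv (pgf p) s = pgf p s

open Classical in
/-- `s₀`: the positive root of `s f'(s) = f(s)` if there is one, and the radius of convergence of
`f` otherwise. (If `p₀ > 0` and `p₀ + p₁ < 1` there is at most one root, and there is one when the
radius of convergence is infinite, so that `toReal` is only applied to a finite radius.) -/
def criticalPoint (p : ℕ → ℝ) : ℝ :=
  if h : ∃ s, IsCriticalRoot p s then h.choose else (pgfRadius p).toReal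

/-- `R = lim_{s ↑ s₀} s / f(s)`. -/
def decayR (p : ℕ → ℝ) : ℝ := limUnder (𝓝[<] (criticalPoint p)) (fun s => s / pgf p s)

/-- The infinite matrix `A = (A_{ij})_{i,j ≥ 0}`: row `0` vanishes, and for `i ≥ 1`,
`A_{ij} = p_{j-i+1}` if `j ≥ i - 1` and `A_{ij} = 0` otherwise. -/
def matA (p : ℕ → ℝ) (i j : ℕ) : ℝ := if 1 ≤ i ∧ i ≤ j + 1 then p (j + 1 - i) else 0

/-- The `k × k` principal truncation `A_k = (A_{ij})_{1 ≤ i, j ≤ k}`. -/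
def truncA (p : ℕ → ℝ) (k : ℕ) : Matrix (Fin k) (Fin k) ℝ :=
  Matrix.of fun i j => matA p (i + 1) (j + 1)

/-- `a` is the Perron-Frobenius eigenvalue of the real matrix `M`: it is an eigenvalue of `M`, and
it dominates the modulus of every complex eigenvalue of `M`. There is at most one such `a`. -/
def IsPerronEigenvalue {k : ℕ} (M : Matrix (Fin k) (Fin k) ℝ) (a : ℝ) : Prop :=
  Module.End.HasEigenvalue (Matrix.toLin' M) a ∧
    ∀ z : ℂ, Module.End.HasEigenvalue (Matrix.toLin' (M.map ((↑) : ℝ → ℂ))) z → ‖z‖ ≤ a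

/-- `α_k`: the largest eigenvalue of `A_k`. -/
def alphaA (p : ℕ → ℝ) (k : ℕ) : ℝ :=
  sSup {a : ℝ | Module.End.HasEigenvalue (Matrix.toLin' (truncA p k)) a}

/-- `k₀ = inf {k ≥ 1 : p_k > 0}`. -/
def kZero (p : ℕ → ℝ) : ℕ := sInf {k : ℕ | 1 ≤ k ∧ 0 < p k}

/-- The operator `T` on `ℓ^q(ℕ)` is given by the infinite matrix `A`:
`(T x)_i = ∑_j A_{ij} x_j` for all `x` and `i`. -/
def IsGivenByA (p : ℕ → ℝ) (q : ℝ≥0∞) [Fact (1 ≤ q)]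
    (T : lp (fun _ : ℕ => ℝ) q →L[ℝ] lp (fun _ : ℕ => ℝ) q) : Prop :=
  ∀ (x : lp (fun _ : ℕ => ℝ) q) (i : ℕ), HasSum (fun j => matA p i j * x j) (T x i)

end

/-! The number `1/R` is the infimum of `f(s)/s` over the `s > 0` at which `f` converges. Indeed `x ↦
f(e^x)/e^x = ∑ pₘ e^{(m-1)x}` is convex, with slope `(s f'(s) - f(s))/s` at `s = e^x`, so `s₀` is
either its minimum or the end of the domain towards which it decreases (`pgf_tangent_le`,
`exists_tendsto_pgf_div`). Both bounds on `α_k` come from Collatz–Wielandt test vectors. Above: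
`(s^i)` is positive and `A_k` multiplies it by at most `f(s)/s` (`alphaA_le`). Below: cut `f` to a
polynomial `f_N` and put `z = s e^{iδ}`, `δ = π/(k+1)`. The powers of `z` are formal eigenvectors
for `f_N(z)/z`. For a suitable `s` this number is real, so the imaginary part `s^n sin(δn)` is an
eigenvector too. It is positive for `1 ≤ n ≤ k` and nonpositive at the indices lost by truncation,
whence `α_k ≥ f_N(z)/z ≥ (1 - (δN)²/2) f_N(s)/s` (`exists_le_alphaA`). As `k, N → ∞` the points `s`
stay in a compact subset of `(0, ∞)`, and a limit point `t` satisfies `1/R ≤ f(t)/t ≤ sup α_k`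
(`exists_pgf_div_le`). The operator is a norm-convergent combination of shifts; it is not compact
because the images of the unit vectors are `p₀`-separated. -/

/-- `μ` is a subinvariance bound for the nonnegative vector `u`: `μ u ≤ M u` entrywise. -/
def IsSubinvariant {ι : Type*} [Fintype ι] (M : Matrix ι ι ℝ) (μ : ℝ) (u : ι → ℝ) : Prop :=
  ∀ i, μ * u i ≤ ∑ j, M i j * u j

/-! ### Perron–Frobenius theory via the Collatz–Wielandt bound. -/

section PerronFrobenius

variable {ι : Type*} [Fintype ι]

lemma IsSubinvariant.le_sum {M : Matrix ι ι ℝ} (hM : ∀ i j, 0 ≤ M i j) {μ : ℝ} {u : ι → ℝ}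
    (hu : u ∈ stdSimplex ℝ ι) (h : IsSubinvariant M μ u) : μ ≤ ∑ i, ∑ j, M i j := by
  have h1 : ∀ j, u j ≤ 1 := fun j => by
    rw [← hu.2]; exact Finset.single_le_sum (fun i _ => hu.1 i) (Finset.mem_univ j)
  calc μ = ∑ i, μ * u i := by rw [← Finset.mul_sum, hu.2, mul_one]
    _ ≤ ∑ i, ∑ j, M i j * u j := Finset.sum_le_sum fun i _ => h i
    _ ≤ ∑ i, ∑ j, M i j := Finset.sum_le_sum fun i _ => Finset.sum_le_sum fun j _ =>
        mul_le_of_le_one_right (hM i j) (h1 j)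

lemma IsSubinvariant.exists_stdSimplex {M : Matrix ι ι ℝ} {μ : ℝ} {u : ι → ℝ}
    (hu : ∀ i, 0 ≤ u i) (hu0 : u ≠ 0) (h : IsSubinvariant M μ u) :
    ∃ w ∈ stdSimplex ℝ ι, IsSubinvariant M μ w := by
  have hpos : 0 < ∑ i, u i := by
    obtain ⟨i, hi⟩ := Function.ne_iff.1 hu0
    exact Finset.sum_pos' (fun i _ => hu i) ⟨i, Finset.mem_univ i, (hu i).lt_of_ne' hi⟩
  refine ⟨fun i => u i / ∑ i, u i, ⟨fun i => div_nonneg (hu i) hpos.le, ?_⟩, fun i => ?_⟩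
  · rw [← Finset.sum_div, div_self hpos.ne']
  · have := div_le_div_of_nonneg_right (h i) hpos.le
    simp only [Finset.sum_div, mul_div_assoc] at this
    exact this

/-- The Collatz–Wielandt bound is attained. -/
lemma exists_max_subinvariant [Nonempty ι] {M : Matrix ι ι ℝ} (hM : ∀ i j, 0 ≤ M i j) :
    ∃ ρ : ℝ, 0 ≤ ρ ∧ ∃ w ∈ stdSimplex ℝ ι, IsSubinvariant M ρ w ∧
      ∀ μ : ℝ, ∀ u ∈ stdSimplex ℝ ι, IsSubinvariant M μ u → μ ≤ ρ := by
  set C := ∑ i, ∑ j, M i j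
  have hC : 0 ≤ C := Finset.sum_nonneg fun i _ => Finset.sum_nonneg fun j _ => hM i j
  have hcl : IsClosed {x : ℝ × (ι → ℝ) | IsSubinvariant M x.1 x.2} := by
    simp only [IsSubinvariant, Set.ofPred_forall]
    exact isClosed_iInter fun i => isClosed_le (by fun_prop) (by fun_prop)
  have hK : IsCompact ((Set.Icc 0 C ×ˢ stdSimplex ℝ ι) ∩ {x | IsSubinvariant M x.1 x.2}) :=
    (isCompact_Icc.prod (isCompact_stdSimplex ℝ ι)).inter_right hcl
  obtain ⟨i⟩ := ‹Nonempty ι›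
  classical
  have hne : ((Set.Icc 0 C ×ˢ stdSimplex ℝ ι) ∩
      {x : ℝ × (ι → ℝ) | IsSubinvariant M x.1 x.2}).Nonempty := by
    refine ⟨(0, Pi.single i 1), ⟨⟨le_rfl, hC⟩, single_mem_stdSimplex ℝ i⟩, fun j => ?_⟩
    rw [zero_mul]
    exact Finset.sum_nonneg fun k _ =>
      mul_nonneg (hM j k) ((single_mem_stdSimplex ℝ i).1 k)
  obtain ⟨⟨ρ, w⟩, ⟨⟨hρ, hw⟩, hs⟩, hmax⟩ := hK.exists_isMaxOn hne continuous_fst.continuousOn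
  refine ⟨ρ, hρ.1, w, hw, hs, fun μ u hu hμ => ?_⟩
  rcases le_total μ 0 with h0 | h0
  · exact h0.trans hρ.1
  · exact hmax (show (μ, u) ∈ _ from ⟨⟨⟨h0, hμ.le_sum hM hu⟩, hu⟩, hμ⟩)

/-- If a maximiser `w` were not an eigenvector, positivity of `M` would make `y = M w` satisfy `ρ y
< M y` in every coordinate, so `ρ` could be raised. -/
lemma exists_perron_of_pos [Nonempty ι] {M : Matrix ι ι ℝ} (hM : ∀ i j, 0 < M i j) :
    ∃ ρ : ℝ, 0 ≤ ρ ∧ ∃ w ∈ stdSimplex ℝ ι, (∀ i, ∑ j, M i j * w j = ρ * w i) ∧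
      ∀ μ : ℝ, ∀ u ∈ stdSimplex ℝ ι, IsSubinvariant M μ u → μ ≤ ρ := by
  obtain ⟨ρ, hρ, w, hw, hs, hmax⟩ := exists_max_subinvariant fun i j => (hM i j).le
  refine ⟨ρ, hρ, w, hw, ?_, hmax⟩
  by_contra! hne
  obtain ⟨i₀, hi₀⟩ := hne
  set y : ι → ℝ := fun i => ∑ j, M i j * w j with hy
  have hwpos : ∃ j, 0 < w j := by
    by_contra! h
    have := hw.2
    have h2 : ∑ j, w j ≤ 0 := Finset.sum_nonpos fun j _ => h j
    linarith
  obtain ⟨j₀, hj₀⟩ := hwpos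
  have hypos : ∀ i, 0 < y i := fun i =>
    Finset.sum_pos' (fun j _ => mul_nonneg (hM i j).le (hw.1 j))
      ⟨j₀, Finset.mem_univ _, mul_pos (hM i j₀) hj₀⟩
  have hlt : ∀ i, ρ * y i < ∑ j, M i j * y j := fun i => by
    rw [hy, Finset.mul_sum]
    simp only
    refine Finset.sum_lt_sum (fun j _ => ?_) ⟨i₀, Finset.mem_univ _, ?_⟩
    · have := mul_le_mul_of_nonneg_left (hs j) (hM i j).le
      linarith
    · have := mul_lt_mul_of_pos_left (lt_of_le_of_ne (hs i₀) (Ne.symm hi₀)) (hM i i₀)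
      linarith
  obtain ⟨i₁, -, hi₁⟩ := Finset.exists_min_image Finset.univ
    (fun i => (∑ j, M i j * y j) / y i) Finset.univ_nonempty
  have hsub : IsSubinvariant M ((∑ j, M i₁ j * y j) / y i₁) y := fun i => by
    have := hi₁ i (Finset.mem_univ i)
    rwa [le_div_iff₀ (hypos i)] at this
  obtain ⟨u, hu, hsu⟩ := hsub.exists_stdSimplex (fun i => (hypos i).le)
    (fun h => (hypos i₀).ne' (congrFun h i₀))
  have h1 := hmax _ u hu hsu
  rw [div_le_iff₀ (hypos i₁)] at h1
  exact absurd h1 (not_le.2 (hlt i₁))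

/-- **Perron–Frobenius** for nonnegative matrices. -/
lemma exists_perron [Nonempty ι] {M : Matrix ι ι ℝ} (hM : ∀ i j, 0 ≤ M i j) :
    ∃ ρ : ℝ, 0 ≤ ρ ∧ ∃ w ∈ stdSimplex ℝ ι, (∀ i, ∑ j, M i j * w j = ρ * w i) ∧
      ∀ μ : ℝ, ∀ u ∈ stdSimplex ℝ ι, IsSubinvariant M μ u → μ ≤ ρ := by
  -- Perturb to positive matrices and pass to a limit by compactness. Since `M ≤ N n` entrywise,
  -- maximality of `ρ n` also covers the subinvariant vectors of `M`.
  set N : ℕ → Matrix ι ι ℝ := fun n => Matrix.of fun i j => M i j + 1 / ((n : ℝ) + 1) with hN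
  have hNpos : ∀ n i j, 0 < N n i j := fun n i j =>
    add_pos_of_nonneg_of_pos (hM i j) Nat.one_div_pos_of_nat
  choose ρ hρ w hw hev hmax using fun n => exists_perron_of_pos (hNpos n)
  set C := ∑ i, ∑ j, (M i j + 1)
  have hb : ∀ n, ρ n ≤ C := fun n => by
    refine (IsSubinvariant.le_sum (fun i j => (hNpos n i j).le) (hw n)
      (fun i => (hev n i).ge)).trans ?_
    refine Finset.sum_le_sum fun i _ => Finset.sum_le_sum fun j _ => ?_
    have h0 : (0 : ℝ) ≤ n := n.cast_nonneg
    have : 1 / ((n : ℝ) + 1) ≤ 1 := by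
      rw [div_le_one (by positivity)]; linarith
    simpa [hN] using this
  obtain ⟨⟨r, v⟩, hrv, φ, hφ, hlim⟩ :=
    ((isCompact_Icc (a := (0 : ℝ)) (b := C)).prod (isCompact_stdSimplex ℝ ι)).tendsto_subseq
      (x := fun n => (ρ n, w n)) (fun n => ⟨⟨hρ n, hb n⟩, hw n⟩)
  have hr : Tendsto (fun n => ρ (φ n)) atTop (𝓝 r) := (continuous_fst.tendsto _).comp hlim
  have hv : ∀ i, Tendsto (fun n => w (φ n) i) atTop (𝓝 (v i)) := fun i =>
    (((continuous_apply i).comp continuous_snd).tendsto _).comp hlim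
  have hNl : ∀ i j, Tendsto (fun n => N (φ n) i j) atTop (𝓝 (M i j)) := fun i j => by
    have := (tendsto_one_div_add_atTop_nhds_zero_nat (𝕜 := ℝ)).comp hφ.tendsto_atTop
    simpa [hN] using this.const_add (M i j)
  refine ⟨r, hrv.1.1, v, hrv.2, fun i => ?_, fun μ u hu hμ => ?_⟩
  · refine tendsto_nhds_unique (tendsto_finsetSum _ fun j _ => (hNl i j).mul (hv j)) ?_
    simpa only [hev] using hr.mul (hv i)
  · refine ge_of_tendsto' hr fun n => hmax _ μ u hu fun i => (hμ i).trans ?_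
    refine Finset.sum_le_sum fun j _ => mul_le_mul_of_nonneg_right ?_ (hu.1 j)
    simp only [hN, Matrix.of_apply]
    linarith [(Nat.one_div_pos_of_nat : 0 < 1 / ((φ n : ℝ) + 1))]

end PerronFrobenius

/-- The largest real eigenvalue of a square matrix. -/
noncomputable def maxEigenvalue {k : ℕ} (M : Matrix (Fin k) (Fin k) ℝ) : ℝ :=
  sSup {a : ℝ | Module.End.HasEigenvalue (Matrix.toLin' M) a}

/-! ### Test-vector bounds for the largest eigenvalue. -/

section MaxEigenvalue

variable {k : ℕ} {M : Matrix (Fin k) (Fin k) ℝ}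

/-- By the triangle inequality, the moduli of an eigenvector's entries form a subinvariant vector.
It is used over both `ℝ` and `ℂ`. -/
lemma exists_norm_subinvariant {𝕜 : Type*} [RCLike 𝕜] {N : Matrix (Fin k) (Fin k) 𝕜}
    (hN : ∀ i j, ‖N i j‖ = M i j) {z : 𝕜}
    (hz : Module.End.HasEigenvalue (Matrix.toLin' N) z) :
    ∃ u ∈ stdSimplex ℝ (Fin k), IsSubinvariant M ‖z‖ u := by
  obtain ⟨v, hv⟩ := hz.exists_hasEigenvector
  have hsub : IsSubinvariant M ‖z‖ (fun i => ‖v i‖) := fun i => by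
    have h := congrFun hv.apply_eq_smul i
    simp only [Matrix.toLin'_apply, Matrix.mulVec, dotProduct, Pi.smul_apply, smul_eq_mul] at h
    rw [← norm_mul, ← h]
    refine (norm_sum_le _ _).trans (Finset.sum_le_sum fun j _ => ?_)
    rw [norm_mul, hN]
  refine hsub.exists_stdSimplex (fun i => norm_nonneg _) fun h => hv.2 ?_
  ext i
  exact norm_eq_zero.1 (congrFun h i)

lemma maxEigenvalue_spec (hk : 1 ≤ k) (hM : ∀ i j, 0 ≤ M i j) :
    0 ≤ maxEigenvalue M ∧ IsPerronEigenvalue M (maxEigenvalue M) ∧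
    (∃ w ∈ stdSimplex ℝ (Fin k), ∀ i, ∑ j, M i j * w j = maxEigenvalue M * w i) ∧
    ∀ μ : ℝ, ∀ u ∈ stdSimplex ℝ (Fin k), IsSubinvariant M μ u → μ ≤ maxEigenvalue M := by
  have : Nonempty (Fin k) := ⟨⟨0, hk⟩⟩
  obtain ⟨ρ, hρ, w, hw, hev, hmax⟩ := exists_perron hM
  have hE : Module.End.HasEigenvalue (Matrix.toLin' M) ρ := by
    refine Module.End.hasEigenvalue_of_hasEigenvector (x := w)
      (Module.End.hasEigenvector_iff.2 ⟨Module.End.mem_eigenspace_iff.2 ?_, ?_⟩)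
    · ext i
      simpa [Matrix.mulVec, dotProduct] using hev i
    · rintro rfl
      simpa using hw.2
  have hρeq : maxEigenvalue M = ρ := by
    refine IsGreatest.csSup_eq ⟨hE, fun a ha => ?_⟩
    obtain ⟨u, hu, hsu⟩ := exists_norm_subinvariant (M := M)
      (fun i j => by rw [Real.norm_of_nonneg (hM i j)]) ha
    exact (le_abs_self a).trans (hmax _ u hu hsu)
  rw [hρeq]
  refine ⟨hρ, ⟨hE, fun z hz => ?_⟩, ⟨w, hw, hev⟩, hmax⟩
  obtain ⟨u, hu, hsu⟩ := exists_norm_subinvariant (M := M)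
    (fun i j => by rw [Matrix.map_apply, Complex.norm_real, Real.norm_of_nonneg (hM i j)]) hz
  exact hmax _ u hu hsu

lemma le_maxEigenvalue (hM : ∀ i j, 0 ≤ M i j) {μ : ℝ} {u : Fin k → ℝ} (hu : ∀ i, 0 ≤ u i)
    (hu0 : u ≠ 0) (h : IsSubinvariant M μ u) : μ ≤ maxEigenvalue M := by
  have hk : 1 ≤ k := by
    obtain ⟨i, -⟩ := Function.ne_iff.1 hu0
    exact i.pos
  obtain ⟨w, hw, hs⟩ := h.exists_stdSimplex hu hu0
  exact (maxEigenvalue_spec hk hM).2.2.2 μ w hw hs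

/-- Scale `v` by the least `c` with `w ≤ c v`, `w` the Perron vector, and compare `M w` with `c M v`
at the coordinate where `w` touches `c v`. -/
lemma maxEigenvalue_le (hk : 1 ≤ k) (hM : ∀ i j, 0 ≤ M i j) {μ : ℝ} {v : Fin k → ℝ}
    (hv : ∀ i, 0 < v i) (h : ∀ i, ∑ j, M i j * v j ≤ μ * v i) : maxEigenvalue M ≤ μ := by
  have : Nonempty (Fin k) := ⟨⟨0, hk⟩⟩
  obtain ⟨hρ, -, ⟨w, hw, hev⟩, -⟩ := maxEigenvalue_spec hk hM
  obtain ⟨i₁, -, hi₁⟩ := Finset.exists_max_image Finset.univ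
    (fun i => w i / v i) Finset.univ_nonempty
  set c := w i₁ / v i₁ with hc
  have hwc : ∀ i, w i ≤ c * v i := fun i => by
    have := hi₁ i (Finset.mem_univ i)
    rwa [div_le_iff₀ (hv i)] at this
  have hcpos : 0 < c := by
    by_contra! hc0
    have h1 : ∑ i, w i ≤ 0 := Finset.sum_nonpos fun i _ =>
      (hwc i).trans (mul_nonpos_of_nonpos_of_nonneg hc0 (hv i).le)
    linarith [hw.2]
  have hwi : w i₁ = c * v i₁ := by rw [hc, div_mul_cancel₀ _ (hv i₁).ne']
  have h2 : maxEigenvalue M * w i₁ ≤ c * (μ * v i₁) := by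
    rw [← hev i₁]
    refine le_trans ?_ (mul_le_mul_of_nonneg_left (h i₁) hcpos.le)
    rw [Finset.mul_sum]
    refine Finset.sum_le_sum fun j _ => ?_
    have := mul_le_mul_of_nonneg_left (hwc j) (hM i₁ j)
    linarith
  rw [hwi] at h2
  have h3 : 0 < c * v i₁ := mul_pos hcpos (hv i₁)
  by_contra! hlt
  nlinarith [mul_lt_mul_of_pos_right hlt h3]

end MaxEigenvalue

/-- `∑ₖ (k - 1) pₖ sᵏ`, which is `s f'(s) - f(s)` inside the disc of convergence. -/
noncomputable def pgfExcess (p : ℕ → ℝ) (s : ℝ) : ℝ := ∑' k : ℕ, ((k : ℝ) - 1) * (p k * s ^ k)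

/-! ### The function `f(s)/s` and its infimum. -/

section Pgf

variable {p : ℕ → ℝ}

lemma summable_pgf_of_lt_radius {s : ℝ} (hs : 0 ≤ s) (hr : ENNReal.ofReal s < pgfRadius p) :
    Summable (fun k => p k * s ^ k) ∧ Summable (fun k : ℕ => (k : ℝ) * (p k * s ^ k)) := by
  obtain ⟨t, hst, htr⟩ := ENNReal.lt_iff_exists_nnreal_btwn.1 hr
  have hst' : s < t := by
    rw [ENNReal.ofReal, ENNReal.coe_lt_coe] at hst
    simpa [Real.coe_toNNReal s hs] using NNReal.coe_lt_coe.2 hst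
  have ht : (0 : ℝ) < t := hs.trans_lt hst'
  obtain ⟨C, hC, hb⟩ := FormalMultilinearSeries.norm_mul_pow_le_of_lt_radius _ htr
  simp only [FormalMultilinearSeries.ofScalars_norm] at hb
  have hq : ‖s / t‖ < 1 := by
    rw [Real.norm_of_nonneg (by positivity), div_lt_one ht]; exact hst'
  have key : ∀ k : ℕ, ‖p k * s ^ k‖ ≤ C * (s / t) ^ k := fun k => by
    have h1 : ‖p k * s ^ k‖ = (‖p k‖ * (t : ℝ) ^ k) * (s / t) ^ k := by
      rw [norm_mul, norm_pow, Real.norm_of_nonneg hs, div_pow]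
      field_simp
    rw [h1]
    exact mul_le_mul_of_nonneg_right (hb k) (by positivity)
  constructor
  · exact Summable.of_norm_bounded
      ((summable_geometric_of_norm_lt_one hq).mul_left C) key
  · refine Summable.of_norm_bounded
      ((summable_pow_mul_geometric_of_norm_lt_one 1 hq).mul_left C) fun k => ?_
    rw [norm_mul, Real.norm_of_nonneg k.cast_nonneg, pow_one]
    calc (k : ℝ) * ‖p k * s ^ k‖ ≤ k * (C * (s / t) ^ k) :=
          mul_le_mul_of_nonneg_left (key k) k.cast_nonneg
      _ = C * (k * (s / t) ^ k) := by ring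

lemma ofReal_le_pgfRadius {s : ℝ} (hs : 0 ≤ s) (h : Summable fun k => p k * s ^ k) :
    ENNReal.ofReal s ≤ pgfRadius p := by
  refine FormalMultilinearSeries.le_radius_of_summable _ ?_
  simpa [FormalMultilinearSeries.ofScalars_norm, Real.coe_toNNReal s hs, abs_of_nonneg hs,
    abs_mul, abs_pow] using h.abs

lemma summable_pgfExcess {s : ℝ} (hs : 0 ≤ s) (hr : ENNReal.ofReal s < pgfRadius p) :
    Summable fun k : ℕ => ((k : ℝ) - 1) * (p k * s ^ k) := by
  obtain ⟨h1, h2⟩ := summable_pgf_of_lt_radius hs hr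
  exact (h2.sub h1).congr fun k => by ring

lemma exists_gt_lt_radius {s : ℝ} (hs : 0 ≤ s) (hr : ENNReal.ofReal s < pgfRadius p) :
    ∃ t, s < t ∧ ENNReal.ofReal t < pgfRadius p := by
  obtain ⟨t, hst, htr⟩ := ENNReal.lt_iff_exists_nnreal_btwn.1 hr
  refine ⟨t, ?_, by rwa [ENNReal.ofReal_coe_nnreal]⟩
  rw [ENNReal.ofReal, ENNReal.coe_lt_coe] at hst
  simpa [Real.coe_toNNReal s hs] using NNReal.coe_lt_coe.2 hst

lemma hasDerivAt_pgf {s : ℝ} (hs : 0 ≤ s) (hr : ENNReal.ofReal s < pgfRadius p) :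
    HasDerivAt (pgf p) (∑' k : ℕ, p k * (k * s ^ (k - 1))) s := by
  obtain ⟨t, hst, htr⟩ := exists_gt_lt_radius hs hr
  have ht : 0 < t := hs.trans_lt hst
  have hu : Summable fun k : ℕ => t⁻¹ * |k * (p k * t ^ k)| :=
    (summable_pgf_of_lt_radius ht.le htr).2.abs.mul_left _
  have hmem : s ∈ Set.Ioo (-t) t := ⟨by linarith, hst⟩
  refine hasDerivAt_tsum_of_isPreconnected hu isOpen_Ioo isPreconnected_Ioo
    (g := fun k y => p k * y ^ k) (g' := fun k y => p k * (k * y ^ (k - 1)))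
    (fun k y _ => (hasDerivAt_pow k y).const_mul (p k)) (fun k y hy => ?_) hmem
    (summable_pgf_of_lt_radius hs hr).1 hmem
  rcases k with _ | k
  · simp
  · have hy' : |y| ≤ t := (abs_lt.2 hy).le
    have h1 : |y| ^ k ≤ t ^ k := pow_le_pow_left₀ (abs_nonneg y) hy' k
    simp only [Nat.add_sub_cancel, Real.norm_eq_abs, abs_mul, abs_pow, Nat.abs_cast, pow_succ,
      abs_of_pos ht]
    calc |p (k + 1)| * (((k + 1 : ℕ) : ℝ) * |y| ^ k)
        ≤ |p (k + 1)| * (((k + 1 : ℕ) : ℝ) * t ^ k) := by gcongr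
      _ = _ := by field_simp

lemma mul_deriv_pgf_sub {s : ℝ} (hs : 0 < s) (hr : ENNReal.ofReal s < pgfRadius p) :
    s * deriv (pgf p) s - pgf p s = pgfExcess p s := by
  obtain ⟨h1, h2⟩ := summable_pgf_of_lt_radius hs.le hr
  rw [(hasDerivAt_pgf hs.le hr).deriv, ← tsum_mul_left, pgf, pgfExcess]
  have h3 : ∀ k : ℕ, s * (p k * (k * s ^ (k - 1))) = k * (p k * s ^ k) := fun k => by
    rcases k with _ | k
    · simp
    · simp only [Nat.add_sub_cancel, pow_succ]; ring
  simp only [h3]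
  rw [← h2.tsum_sub h1]
  exact tsum_congr fun k => by ring

lemma isCriticalRoot_iff {s : ℝ} :
    IsCriticalRoot p s ↔ 0 < s ∧ ENNReal.ofReal s < pgfRadius p ∧ pgfExcess p s = 0 := by
  constructor
  · rintro ⟨h0, hr, h⟩
    exact ⟨h0, hr, by rw [← mul_deriv_pgf_sub h0 hr, h, sub_self]⟩
  · rintro ⟨h0, hr, h⟩
    exact ⟨h0, hr, sub_eq_zero.1 (by rw [mul_deriv_pgf_sub h0 hr, h])⟩

lemma continuousOn_pgfExcess {t : ℝ} (ht : 0 ≤ t) (hr : ENNReal.ofReal t < pgfRadius p) :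
    ContinuousOn (pgfExcess p) (Set.Icc 0 t) := by
  refine continuousOn_tsum (fun k => by fun_prop)
    (u := fun k : ℕ => |((k : ℝ) - 1) * (p k * t ^ k)|) (summable_pgfExcess ht hr).abs ?_
  rintro k s ⟨h0, h1⟩
  simp only [Real.norm_eq_abs, abs_mul, abs_pow, abs_of_nonneg h0, abs_of_nonneg ht]
  gcongr

lemma pgfExcess_zero : pgfExcess p 0 = -p 0 := by
  rw [pgfExcess, tsum_eq_single 0 fun k hk => by simp [hk]]
  simp

/-- This is the tangent inequality at `log t` for the convex function `x ↦ f(e^x)/e^x`; termwise it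
is `1 + y ≤ e^y` with `y = (k-1) log(s/t)`. -/
lemma pgf_tangent_le (hp : ∀ k, 0 ≤ p k) {s t : ℝ} (hs : 0 < s)
    (hss : Summable fun k => p k * s ^ k) (ht : 0 < t) (hr : ENNReal.ofReal t < pgfRadius p) :
    pgf p t / t + Real.log (s / t) * (pgfExcess p t / t) ≤ pgf p s / s := by
  have h1 := (summable_pgf_of_lt_radius ht.le hr).1
  have h2 := summable_pgfExcess ht.le hr
  have hq : 0 < s / t := div_pos hs ht
  refine hasSum_le (fun k => ?_) ((h1.hasSum.div_const t).add
    ((h2.hasSum.div_const t).mul_left (Real.log (s / t)))) (hss.hasSum.div_const s)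
  have h3 := Real.add_one_le_exp (((k : ℝ) - 1) * Real.log (s / t))
  have h4 : Real.exp (((k : ℝ) - 1) * Real.log (s / t)) = (s / t) ^ k / (s / t) := by
    rw [sub_mul, one_mul, Real.exp_sub, Real.exp_log hq, Real.exp_nat_mul, Real.exp_log hq]
  rw [h4] at h3
  have h5 : 0 ≤ p k * t ^ k / t := by have := hp k; positivity
  have h6 := mul_le_mul_of_nonneg_left h3 h5
  have h7 : p k * t ^ k / t * ((s / t) ^ k / (s / t)) = p k * s ^ k / s := by
    rw [div_pow]; field_simp
  rw [h7] at h6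
  refine le_trans (le_of_eq ?_) h6
  ring

lemma le_pgf (hp : ∀ k, 0 ≤ p k) {s : ℝ} (hs : 0 ≤ s) (h : Summable fun k => p k * s ^ k) :
    p 0 ≤ pgf p s := by
  have := h.le_tsum 0 fun k _ => mul_nonneg (hp k) (pow_nonneg hs k)
  simpa [pgf] using this

lemma exists_isCriticalRoot (hp : ∀ k, 0 ≤ p k) (hp0 : 0 < p 0) {K : ℕ} (hK : 2 ≤ K)
    (hpK : 0 < p K) (hr : pgfRadius p = ∞) : ∃ s, IsCriticalRoot p s := by
  have hlt : ∀ s : ℝ, ENNReal.ofReal s < pgfRadius p := fun s => by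
    rw [hr]; exact ENNReal.ofReal_lt_top
  have hK1 : (1 : ℝ) ≤ (K : ℝ) - 1 := by
    have : (2 : ℝ) ≤ K := by exact_mod_cast hK
    linarith
  -- Chosen so that `p K * S = p K + p 0`, which outweighs the only negative term, `-p 0`.
  set S : ℝ := 1 + p 0 / p K with hS
  have hS1 : 1 ≤ S := by rw [hS]; linarith [div_pos hp0 hpK]
  have hpos : 0 ≤ pgfExcess p S := by
    have hsum := (summable_pgfExcess (p := p) (zero_le_one.trans hS1) (hlt S))
    have h1 := hsum.sum_le_tsum {0, K} (fun k hk => by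
      have hk0 : k ≠ 0 := fun h => hk (by simp [h])
      have : (1 : ℝ) ≤ k := by exact_mod_cast Nat.one_le_iff_ne_zero.2 hk0
      have := hp k
      have : 0 ≤ S := by linarith
      exact mul_nonneg (by linarith) (by positivity))
    rw [Finset.sum_pair (by omega)] at h1
    have h2 : S ≤ S ^ K := le_self_pow₀ hS1 (by omega)
    have h3 : p K * S ≤ ((K : ℝ) - 1) * (p K * S ^ K) := by
      have h4 : p K * S ≤ p K * S ^ K := mul_le_mul_of_nonneg_left h2 hpK.le
      have h5 : 0 ≤ p K * S ^ K := by positivity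
      nlinarith
    have h6 : p K * S = p K + p 0 := by rw [hS]; field_simp
    have h7 : -p 0 + ((K : ℝ) - 1) * (p K * S ^ K) ≤ pgfExcess p S := by
      simpa [pgfExcess] using h1
    linarith
  obtain ⟨s, ⟨hs0, -⟩, hs⟩ := intermediate_value_Icc (zero_le_one.trans hS1)
    (continuousOn_pgfExcess (p := p) (zero_le_one.trans hS1) (hlt S))
    (show (0 : ℝ) ∈ Set.Icc _ _ from ⟨by rw [pgfExcess_zero]; linarith, hpos⟩)
  refine ⟨s, isCriticalRoot_iff.2 ⟨hs0.lt_of_ne' ?_, hlt s, hs⟩⟩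
  rintro rfl
  rw [pgfExcess_zero] at hs
  linarith

/-- The limit of `f(s) / s` as `s ↑ s₀` exists, and is a lower bound of `f(s) / s`. -/
lemma exists_tendsto_pgf_div (hp : ∀ k, 0 ≤ p k) (hp0 : 0 < p 0) (hsum : Summable p) {K : ℕ}
    (hK : 2 ≤ K) (hpK : 0 < p K) :
    ∃ L, 0 < L ∧ Tendsto (fun s => pgf p s / s) (𝓝[<] (criticalPoint p)) (𝓝 L) ∧
      (∀ s, 0 < s → (Summable fun k => p k * s ^ k) → L ≤ pgf p s / s) ∧
      ∀ᶠ s in 𝓝[<] (criticalPoint p), 0 < s ∧ ENNReal.ofReal s < pgfRadius p := by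
  by_cases h : ∃ s, IsCriticalRoot p s
  · have hc : criticalPoint p = h.choose := dif_pos h
    obtain ⟨h0, hr, hE⟩ := isCriticalRoot_iff.1 h.choose_spec
    rw [hc]
    set s₀ := h.choose
    refine ⟨pgf p s₀ / s₀, div_pos (hp0.trans_le (le_pgf hp h0.le
      (summable_pgf_of_lt_radius h0.le hr).1)) h0, ?_, fun s hs hss => ?_, ?_⟩
    · exact ((hasDerivAt_pgf h0.le hr).continuousAt.div continuousAt_id h0.ne').tendsto.mono_left
        nhdsWithin_le_nhds
    -- At any root the tangent is horizontal, so it is a global minimum; uniqueness of the root is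
    -- not needed.
    · simpa [hE] using pgf_tangent_le hp hs hss h0 hr
    · filter_upwards [Ioo_mem_nhdsLT h0] with s hs
      exact ⟨hs.1, (ENNReal.ofReal_le_ofReal hs.2.le).trans_lt hr⟩
  · have hc : criticalPoint p = (pgfRadius p).toReal := dif_neg h
    have hfin : pgfRadius p ≠ ∞ := fun hr => h (exists_isCriticalRoot hp hp0 hK hpK hr)
    rw [hc]
    set r := (pgfRadius p).toReal with hrdef
    have hrr : ENNReal.ofReal r = pgfRadius p := ENNReal.ofReal_toReal hfin
    have hr0 : 0 < r := by
      have h1 := ofReal_le_pgfRadius (p := p) zero_le_one (by simpa using hsum)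
      rw [← hrr, ENNReal.ofReal_le_ofReal_iff ENNReal.toReal_nonneg] at h1
      linarith
    have hlt : ∀ s, s < r → ENNReal.ofReal s < pgfRadius p := fun s hs => by
      rw [← hrr]; exact (ENNReal.ofReal_lt_ofReal_iff hr0).2 hs
    -- With no root the excess keeps the sign it has at `0`, so `f(s)/s` decreases on `(0, r)` and
    -- its left limit at `r` is its infimum.
    have hneg : ∀ t ∈ Set.Ioo 0 r, pgfExcess p t < 0 := fun t ht => by
      by_contra! hge
      obtain ⟨s, ⟨hs0, hst⟩, hs⟩ := intermediate_value_Icc ht.1.le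
        (continuousOn_pgfExcess (p := p) ht.1.le (hlt t ht.2))
        (show (0 : ℝ) ∈ Set.Icc _ _ from ⟨by rw [pgfExcess_zero]; linarith, hge⟩)
      refine h ⟨s, isCriticalRoot_iff.2 ⟨hs0.lt_of_ne' ?_, hlt s (hst.trans_lt ht.2), hs⟩⟩
      rintro rfl
      rw [pgfExcess_zero] at hs
      linarith
    have hsm : ∀ t ∈ Set.Ioo 0 r, Summable fun k => p k * t ^ k := fun t ht =>
      (summable_pgf_of_lt_radius ht.1.le (hlt t ht.2)).1
    have hanti : AntitoneOn (fun s => pgf p s / s) (Set.Ioo 0 r) := fun s hs t ht hst => by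
      have h1 := pgf_tangent_le hp hs.1 (hsm s hs) ht.1 (hlt t ht.2)
      have h2 : Real.log (s / t) ≤ 0 :=
        Real.log_nonpos (div_nonneg hs.1.le ht.1.le) ((div_le_one ht.1).2 hst)
      have h3 : pgfExcess p t / t ≤ 0 := div_nonpos_of_nonpos_of_nonneg (hneg t ht).le ht.1.le
      have h4 := mul_nonneg_of_nonpos_of_nonpos h2 h3
      simp only
      linarith
    have hlow : ∀ t ∈ Set.Ioo 0 r, p 0 / r ≤ pgf p t / t := fun t ht =>
      div_le_div₀ (hp0.le.trans (le_pgf hp ht.1.le (hsm t ht))) (le_pgf hp ht.1.le (hsm t ht))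
        ht.1 ht.2.le
    have hne : (Set.Ioo 0 r).Nonempty := Set.nonempty_Ioo.2 hr0
    have hbdd : BddBelow ((fun s => pgf p s / s) '' Set.Ioo 0 r) :=
      ⟨p 0 / r, by rintro _ ⟨t, ht, rfl⟩; exact hlow t ht⟩
    refine ⟨sInf ((fun s => pgf p s / s) '' Set.Ioo 0 r), ?_, ?_, fun s hs hss => ?_, ?_⟩
    · refine (div_pos hp0 hr0).trans_le (le_csInf (hne.image _) ?_)
      rintro _ ⟨t, ht, rfl⟩
      exact hlow t ht
    · have := hanti.dual_right.tendsto_nhdsWithin_Ioo_left hne hbdd.dual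
      exact this
    · have hsr : s ≤ r := by
        have := ofReal_le_pgfRadius hs.le hss
        rwa [← hrr, ENNReal.ofReal_le_ofReal_iff hr0.le] at this
      -- The series may converge at `s = r` itself. Comparing `f(t)` with `f(s)` for `t < s` and
      -- letting `t ↑ s` covers this endpoint.
      have hle : ∀ t ∈ Set.Ioo 0 s,
          sInf ((fun s => pgf p s / s) '' Set.Ioo 0 r) ≤ pgf p s / t := fun t ht => by
        have htr : t ∈ Set.Ioo 0 r := ⟨ht.1, ht.2.trans_le hsr⟩
        refine (csInf_le hbdd ⟨t, htr, rfl⟩).trans ?_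
        refine div_le_div_of_nonneg_right ((hsm t htr).tsum_le_tsum (fun k => ?_) hss) ht.1.le
        exact mul_le_mul_of_nonneg_left (pow_le_pow_left₀ ht.1.le ht.2.le k) (hp k)
      have htend : Tendsto (fun t => pgf p s / t) (𝓝[<] s) (𝓝 (pgf p s / s)) :=
        (tendsto_const_nhds.div tendsto_id hs.ne').mono_left nhdsWithin_le_nhds
      refine ge_of_tendsto htend ?_
      filter_upwards [Ioo_mem_nhdsLT hs] with t ht using hle t ht
    · filter_upwards [Ioo_mem_nhdsLT hr0] with s hs
      exact ⟨hs.1, hlt s hs.2⟩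

end Pgf

/-! ### Upper and lower bounds for `α_k`, and its limit. -/

section Truncation

variable {p : ℕ → ℝ}

lemma truncA_apply {k : ℕ} (i j : Fin k) :
    truncA p k i j = if (i : ℕ) ≤ j + 1 then p (j + 1 - i) else 0 := by
  simp [truncA, matA]

lemma truncA_nonneg (hp : ∀ k, 0 ≤ p k) {k : ℕ} (i j : Fin k) : 0 ≤ truncA p k i j := by
  rw [truncA_apply]
  split_ifs
  exacts [hp _, le_rfl]

/-- Reindexing by `m = j + 1 - i`: the `Fin` index `i` stands for row `i + 1`, and the filter
removes column `0`. -/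
lemma sum_truncA_mul {k : ℕ} (i : Fin k) (u : ℕ → ℝ) :
    ∑ j : Fin k, truncA p k i j * u (j + 1) =
      ∑ m ∈ (Finset.range (k + 1 - i)).filter (fun m => 1 ≤ (i : ℕ) + m), p m * u (i + m) := by
  simp only [truncA_apply]
  rw [Fin.sum_univ_eq_sum_range
    (fun j => (if (i : ℕ) ≤ j + 1 then p (j + 1 - i) else 0) * u (j + 1)) k]
  simp only [ite_mul, zero_mul]
  rw [← Finset.sum_filter]
  refine Finset.sum_nbij' (fun j => j + 1 - (i : ℕ)) (fun m => i + m - 1) ?_ ?_ ?_ ?_ ?_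
  · intro j hj
    simp only [Finset.mem_filter, Finset.mem_range] at hj ⊢
    omega
  · intro m hm
    simp only [Finset.mem_filter, Finset.mem_range] at hm ⊢
    omega
  · intro j hj
    simp only [Finset.mem_filter, Finset.mem_range] at hj
    omega
  · intro m hm
    simp only [Finset.mem_filter, Finset.mem_range] at hm
    omega
  · intro j hj
    simp only [Finset.mem_filter, Finset.mem_range] at hj
    rw [Nat.add_sub_cancel' hj.2]

/-- The test vector is `(s^i)`: on the full nonnegative row it gives at most the factor `f(s)/s`,
and truncation only drops nonnegative terms. Here `alphaA p k` unfolds to `maxEigenvalue (truncA p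
k)`. -/
lemma alphaA_le (hp : ∀ k, 0 ≤ p k) {k : ℕ} (hk : 1 ≤ k) {s : ℝ} (hs : 0 < s)
    (hss : Summable fun k => p k * s ^ k) : alphaA p k ≤ pgf p s / s := by
  refine maxEigenvalue_le hk (truncA_nonneg hp) (v := fun i => s ^ ((i : ℕ) + 1))
    (fun i => by positivity) fun i => ?_
  rw [sum_truncA_mul i (fun n => s ^ n)]
  have h1 : pgf p s / s * s ^ ((i : ℕ) + 1) = s ^ (i : ℕ) * pgf p s := by
    rw [pow_succ]; field_simp
  rw [h1]
  calc _ = s ^ (i : ℕ) * ∑ m ∈ (Finset.range (k + 1 - i)).filter (fun m => 1 ≤ (i : ℕ) + m),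
        p m * s ^ m := by
        rw [Finset.mul_sum]; exact Finset.sum_congr rfl fun m _ => by rw [pow_add]; ring
    _ ≤ _ := mul_le_mul_of_nonneg_left
        (hss.sum_le_tsum _ fun m _ => mul_nonneg (hp m) (by positivity)) (by positivity)

/-- The Perron vector of `A_k`, extended by `0`, is subinvariant for `A_{k+1}`. -/
lemma alphaA_le_succ (hp : ∀ k, 0 ≤ p k) {k : ℕ} (hk : 1 ≤ k) :
    alphaA p k ≤ alphaA p (k + 1) := by
  obtain ⟨-, -, ⟨w, hw, hev⟩, -⟩ := maxEigenvalue_spec hk (truncA_nonneg (p := p) hp)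
  have hu : ∀ i, 0 ≤ (Fin.snoc w 0 : Fin (k + 1) → ℝ) i := fun i => by
    refine Fin.lastCases ?_ (fun i => ?_) i
    · simp
    · simpa using hw.1 i
  refine le_maxEigenvalue (truncA_nonneg hp) (u := (Fin.snoc w 0 : Fin (k + 1) → ℝ)) hu ?_ ?_
  · intro h
    have hw0 : w = 0 := by
      ext i
      simpa using congrFun h i.castSucc
    have := hw.2
    simp [hw0] at this
  · intro i
    refine Fin.lastCases ?_ (fun i => ?_) i
    · simp only [Fin.snoc_last, mul_zero]
      exact Finset.sum_nonneg fun j _ => mul_nonneg (truncA_nonneg hp _ _) (hu j)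
    · have h1 : ∀ j : Fin k, truncA p (k + 1) i.castSucc j.castSucc = truncA p k i j := fun j => by
        simp [truncA_apply]
      rw [Fin.sum_univ_castSucc]
      simp only [Fin.snoc_castSucc, Fin.snoc_last, mul_zero, add_zero, h1]
      exact (hev i).ge

lemma alphaA_mono (hp : ∀ k, 0 ≤ p k) : MonotoneOn (alphaA p) (Set.Ici 1) := by
  intro a ha b _ hab
  induction b, hab using Nat.le_induction with
  | base => exact le_rfl
  | succ n hn ih => exact (ih (le_trans ha hn)).trans (alphaA_le_succ hp (le_trans ha hn))

/-- For the constant vector, the first row sum contains `p K` and every other one contains `p 0`. -/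
lemma alphaA_pos (hp : ∀ k, 0 ≤ p k) (hp0 : 0 < p 0) {K k : ℕ} (hK : 1 ≤ K) (hpK : 0 < p K)
    (hk : K ≤ k) : 0 < alphaA p k := by
  refine (lt_min hp0 hpK).trans_le (le_maxEigenvalue (truncA_nonneg hp) (u := fun _ => 1)
    (fun _ => zero_le_one) (fun h => one_ne_zero (congrFun h ⟨0, by omega⟩)) fun i => ?_)
  rw [sum_truncA_mul i (fun _ => 1)]
  simp only [mul_one]
  rcases Nat.eq_zero_or_pos (i : ℕ) with hi | hi
  · refine (min_le_right _ _).trans (Finset.single_le_sum (f := p) (fun m _ => hp m) ?_)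
    simp only [Finset.mem_filter, Finset.mem_range]
    omega
  · refine (min_le_left _ _).trans (Finset.single_le_sum (f := p) (fun m _ => hp m) ?_)
    have := i.isLt
    simp only [Finset.mem_filter, Finset.mem_range]
    omega

/-- There is `s > 0` for which `∑ₘ pₘ sᵐ e^{iδ(m-1)}` is real. -/
lemma exists_sum_sin_eq_zero (hp : ∀ k, 0 ≤ p k) (hp0 : 0 < p 0) {K N : ℕ} (hK : 2 ≤ K)
    (hpK : 0 < p K) (hN : K ≤ N) {δ : ℝ} (hδ : 0 < δ) (hδN : δ * N < Real.pi) :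
    ∃ s, 0 < s ∧ ∑ m ∈ Finset.range (N + 1), p m * s ^ m * Real.sin (δ * ((m : ℝ) - 1)) = 0 := by
  set H : ℝ → ℝ := fun s =>
    ∑ m ∈ Finset.range (N + 1), p m * s ^ m * Real.sin (δ * ((m : ℝ) - 1)) with hH
  have hle : ∀ m : ℕ, m ≤ N → δ * m ≤ δ * N := fun m hm =>
    mul_le_mul_of_nonneg_left (by exact_mod_cast hm) hδ.le
  have hK2 : (2 : ℝ) ≤ K := by exact_mod_cast hK
  have hsin0 : 0 < Real.sin δ := by
    refine Real.sin_pos_of_pos_of_lt_pi hδ ?_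
    have := hle K hN
    nlinarith
  have hsinK : 0 < Real.sin (δ * ((K : ℝ) - 1)) := by
    refine Real.sin_pos_of_pos_of_lt_pi (mul_pos hδ (by linarith)) ?_
    have := hle K hN
    linarith
  have hsin : ∀ m : ℕ, 1 ≤ m → m ≤ N → 0 ≤ Real.sin (δ * ((m : ℝ) - 1)) := fun m h1 hm => by
    have h1' : (1 : ℝ) ≤ m := by exact_mod_cast h1
    refine Real.sin_nonneg_of_nonneg_of_le_pi (mul_nonneg hδ.le (by linarith)) ?_
    have := hle m hm
    linarith
  have hH0 : H 0 < 0 := by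
    have : H 0 = -(p 0 * Real.sin δ) := by
      simp only [hH]
      rw [Finset.sum_eq_single 0 (fun m _ hm => by simp [hm]) (fun h => by simp at h)]
      simp
    rw [this]
    linarith [mul_pos hp0 hsin0]
  set a := p 0 * Real.sin δ with ha
  set b := p K * Real.sin (δ * ((K : ℝ) - 1)) with hb
  have hapos : 0 < a := mul_pos hp0 hsin0
  have hbpos : 0 < b := mul_pos hpK hsinK
  -- As `δN < π`, only the term `m = 0` is negative; `b * S = b + a` lets the term `m = K` outweigh
  -- it.
  set S := 1 + a / b with hS
  have hS1 : 1 ≤ S := by rw [hS]; linarith [div_pos hapos hbpos]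
  have hS0 : 0 ≤ S := by linarith
  have hHS : 0 ≤ H S := by
    have h1 : ∑ m ∈ {0, K}, p m * S ^ m * Real.sin (δ * ((m : ℝ) - 1)) ≤ H S := by
      refine Finset.sum_le_sum_of_subset_of_nonneg ?_ fun m hm hm0 => ?_
      · intro m hm
        simp only [Finset.mem_insert, Finset.mem_singleton, Finset.mem_range] at hm ⊢
        omega
      · simp only [Finset.mem_insert, Finset.mem_singleton, Finset.mem_range] at hm hm0
        exact mul_nonneg (mul_nonneg (hp m) (by positivity)) (hsin m (by omega) (by omega))
    rw [Finset.sum_pair (by omega)] at h1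
    have h2 : S ≤ S ^ K := le_self_pow₀ hS1 (by omega)
    have h3 : b * S = b + a := by rw [hS]; field_simp
    have h4 : b * S ≤ b * S ^ K := mul_le_mul_of_nonneg_left h2 hbpos.le
    have h5 : p 0 * S ^ 0 * Real.sin (δ * (((0 : ℕ) : ℝ) - 1)) = -a := by simp [ha]
    have h6 : p K * S ^ K * Real.sin (δ * ((K : ℝ) - 1)) = b * S ^ K := by rw [hb]; ring
    rw [h5, h6] at h1
    linarith
  obtain ⟨s, ⟨hs0, -⟩, hs⟩ := intermediate_value_Icc hS0
    (show ContinuousOn H (Set.Icc 0 S) by fun_prop)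
    (show (0 : ℝ) ∈ Set.Icc _ _ from ⟨hH0.le, hHS⟩)
  refine ⟨s, hs0.lt_of_ne' ?_, hs⟩
  rintro rfl
  linarith

/-- The vector `s^n sin(δn)`, `δ = π/(k+1)`, vanishes at `n = 0` and `n = k+1`; with `s` from
`exists_sum_sin_eq_zero` it is subinvariant with factor `c / s`. -/
lemma exists_le_alphaA (hp : ∀ k, 0 ≤ p k) (hp0 : 0 < p 0) {K N k : ℕ} (hK : 2 ≤ K)
    (hpK : 0 < p K) (hN : K ≤ N) (hk : N ≤ k) :
    ∃ s, 0 < s ∧ (1 - (Real.pi / (k + 1) * N) ^ 2 / 2) *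
      ∑ m ∈ Finset.range (N + 1), p m * s ^ m ≤ alphaA p k * s := by
  set δ : ℝ := Real.pi / (k + 1) with hδdef
  have hk1 : (0 : ℝ) < (k : ℝ) + 1 := by positivity
  have hδ : 0 < δ := div_pos Real.pi_pos hk1
  have hδk : δ * ((k : ℝ) + 1) = Real.pi := by rw [hδdef]; field_simp
  have hNk : (N : ℝ) ≤ k := by exact_mod_cast hk
  have hδN : δ * N < Real.pi := by nlinarith
  obtain ⟨s, hs, hsin⟩ := exists_sum_sin_eq_zero hp hp0 hK hpK hN hδ hδN
  refine ⟨s, hs, ?_⟩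
  set c := ∑ m ∈ Finset.range (N + 1), p m * s ^ m * Real.cos (δ * ((m : ℝ) - 1)) with hc
  have hsinpos : ∀ y : ℕ, y ≤ k → 0 ≤ Real.sin (δ * y) := fun y hy => by
    have : (y : ℝ) ≤ k := by exact_mod_cast hy
    exact Real.sin_nonneg_of_nonneg_of_le_pi (by positivity) (by nlinarith)
  have hsinneg : ∀ y : ℕ, k + 1 ≤ y → y ≤ 2 * (k + 1) → Real.sin (δ * y) ≤ 0 := fun y h1 h2 => by
    have h1' : (k : ℝ) + 1 ≤ y := by exact_mod_cast h1
    have h2' : (y : ℝ) ≤ 2 * (k + 1) := by exact_mod_cast h2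
    have h3 : 0 ≤ Real.sin (δ * y - Real.pi) :=
      Real.sin_nonneg_of_nonneg_of_le_pi (by nlinarith) (by nlinarith)
    rw [Real.sin_sub_pi] at h3
    linarith
  have hαc : c / s ≤ alphaA p k := by
    refine le_maxEigenvalue (truncA_nonneg hp)
      (u := fun i => s ^ ((i : ℕ) + 1) * Real.sin (δ * ((i : ℕ) + 1 : ℕ)))
      (fun i => mul_nonneg (by positivity) (hsinpos _ i.isLt)) ?_ fun i => ?_
    · intro h
      have h1 := congrFun h ⟨0, by omega⟩
      have h2 : 0 < Real.sin (δ * 1) :=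
        Real.sin_pos_of_pos_of_lt_pi (by linarith)
          (by
            have : (2 : ℝ) ≤ N := by exact_mod_cast hK.trans hN
            nlinarith)
      simp only [Pi.zero_apply, zero_add, pow_one, Nat.cast_one] at h1
      exact (mul_pos hs h2).ne' h1
    · rw [sum_truncA_mul i (fun n => s ^ n * Real.sin (δ * n))]
      have hi := i.isLt
      have h1 : c / s * (s ^ ((i : ℕ) + 1) * Real.sin (δ * ((i : ℕ) + 1 : ℕ))) =
          ∑ m ∈ Finset.range (N + 1),
            p m * (s ^ ((i : ℕ) + m) * Real.sin (δ * ((i : ℕ) + m : ℕ))) := by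
        -- Addition formula for `δ(i+m) = δ(i+1) + δ(m-1)`; summed over `m`, the second part
        -- vanishes by the choice of `s`.
        have h2 : ∀ m : ℕ, p m * (s ^ ((i : ℕ) + m) * Real.sin (δ * ((i : ℕ) + m : ℕ))) =
            s ^ (i : ℕ) * Real.sin (δ * ((i : ℕ) + 1 : ℕ)) *
              (p m * s ^ m * Real.cos (δ * ((m : ℝ) - 1))) +
            s ^ (i : ℕ) * Real.cos (δ * ((i : ℕ) + 1 : ℕ)) *
              (p m * s ^ m * Real.sin (δ * ((m : ℝ) - 1))) := fun m => by
          have h3 : δ * (((i : ℕ) + m : ℕ) : ℝ) =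
              δ * (((i : ℕ) + 1 : ℕ) : ℝ) + δ * ((m : ℝ) - 1) := by
            push_cast; ring
          rw [h3, Real.sin_add, pow_add]
          ring
        simp only [h2]
        rw [Finset.sum_add_distrib, ← Finset.mul_sum, ← Finset.mul_sum, hsin, ← hc, pow_succ]
        field_simp
        ring
      rw [h1]
      set Q := (Finset.range (k + 1 - i)).filter (fun m => 1 ≤ (i : ℕ) + m)
      -- Terms missing from the truncated row have `i + m = 0` or `k + 1 ≤ i + m ≤ 2k`, where the
      -- sine is zero or nonpositive. Dropping them only helps.
      have h4 : ∀ m ∈ Finset.range (N + 1), m ∉ Q →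
          p m * (s ^ ((i : ℕ) + m) * Real.sin (δ * ((i : ℕ) + m : ℕ))) ≤ 0 := fun m hm hmQ => by
        simp only [Q, Finset.mem_filter, Finset.mem_range] at hm hmQ
        rcases Nat.eq_zero_or_pos ((i : ℕ) + m) with h0 | h0
        · simp [h0]
        · refine mul_nonpos_of_nonneg_of_nonpos (hp m)
            (mul_nonpos_of_nonneg_of_nonpos (by positivity) (hsinneg _ ?_ ?_)) <;> omega
      have h5 : ∀ m ∈ Q, 0 ≤ p m * (s ^ ((i : ℕ) + m) * Real.sin (δ * ((i : ℕ) + m : ℕ))) :=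
        fun m hm => by
          simp only [Q, Finset.mem_filter, Finset.mem_range] at hm
          exact mul_nonneg (hp m) (mul_nonneg (by positivity) (hsinpos _ (by omega)))
      rw [← Finset.sum_filter_add_sum_filter_not (Finset.range (N + 1)) (· ∈ Q)]
      have h6 := Finset.sum_nonpos fun m (hm : m ∈ (Finset.range (N + 1)).filter (· ∉ Q)) =>
        h4 m (Finset.mem_filter.1 hm).1 (Finset.mem_filter.1 hm).2
      have h7 := Finset.sum_le_sum_of_subset_of_nonneg
        (s := (Finset.range (N + 1)).filter (· ∈ Q)) (t := Q)
        (fun m hm => (Finset.mem_filter.1 hm).2) (fun m hm _ => h5 m hm)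
      linarith
  rw [div_le_iff₀ hs] at hαc
  refine le_trans ?_ hαc
  rw [hc, Finset.mul_sum]
  refine Finset.sum_le_sum fun m hm => ?_
  have hm' : (m : ℝ) ≤ N := by exact_mod_cast Nat.lt_succ_iff.1 (Finset.mem_range.1 hm)
  have hN1 : (2 : ℝ) ≤ N := by exact_mod_cast hK.trans hN
  have hm0 : (0 : ℝ) ≤ m := m.cast_nonneg
  have h1 : (δ * ((m : ℝ) - 1)) ^ 2 ≤ (δ * N) ^ 2 := by
    rw [mul_pow, mul_pow]
    exact mul_le_mul_of_nonneg_left (by nlinarith) (by positivity)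
  have h2 := Real.one_sub_sq_div_two_le_cos (x := δ * ((m : ℝ) - 1))
  have h3 : 0 ≤ p m * s ^ m := mul_nonneg (hp m) (by positivity)
  rw [mul_comm]
  exact mul_le_mul_of_nonneg_left (by linarith) h3

/-- An upper bound of the `α_k` is at least `f(s) / s` for some `s` at which `f` converges. -/
lemma exists_pgf_div_le (hp : ∀ k, 0 ≤ p k) (hp0 : 0 < p 0) {K : ℕ} (hK : 2 ≤ K)
    (hpK : 0 < p K) {l : ℝ} (hl : ∀ k, 1 ≤ k → alphaA p k ≤ l) :
    ∃ s, 0 < s ∧ (Summable fun k => p k * s ^ k) ∧ pgf p s / s ≤ l := by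
  -- Take `N = n + K`, then `k` so large that the cosine loss is below `1/(n+2)`. This is at most
  -- `1/2`, hence the factor `2` in `hpart`.
  have key : ∀ n : ℕ, ∃ s, 0 < s ∧ (1 - 1 / ((n : ℝ) + 2)) *
      ∑ m ∈ Finset.range (n + K + 1), p m * s ^ m ≤ l * s := fun n => by
    have hlim : Tendsto (fun k : ℕ => (Real.pi / ((k : ℝ) + 1) * (n + K : ℕ)) ^ 2 / 2) atTop
        (𝓝 0) := by
      have h1 := (tendsto_one_div_add_atTop_nhds_zero_nat (𝕜 := ℝ)).const_mul Real.pi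
      have h2 := ((h1.mul_const ((n + K : ℕ) : ℝ)).pow 2).div_const 2
      simpa [div_eq_mul_inv] using h2
    have hpos : (0 : ℝ) < 1 / ((n : ℝ) + 2) := by positivity
    obtain ⟨k, hk1, hk2⟩ :=
      ((hlim.eventually (gt_mem_nhds hpos)).and (eventually_ge_atTop (n + K))).exists
    obtain ⟨s, hs, h⟩ := exists_le_alphaA hp hp0 hK hpK (Nat.le_add_left K n) hk2
    refine ⟨s, hs, le_trans ?_ (h.trans (mul_le_mul_of_nonneg_right (hl k (by omega)) hs.le))⟩
    refine mul_le_mul_of_nonneg_right (by linarith) ?_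
    exact Finset.sum_nonneg fun m _ => mul_nonneg (hp m) (by positivity)
  choose s hs hle using key
  have hterm : ∀ n m, 0 ≤ p m * s n ^ m := fun n m => mul_nonneg (hp m) (pow_nonneg (hs n).le m)
  have hhalf : ∀ n : ℕ, (1 : ℝ) / ((n : ℝ) + 2) ≤ 1 / 2 := fun n => by
    have : (0 : ℝ) ≤ n := n.cast_nonneg
    exact one_div_le_one_div_of_le (by norm_num) (by linarith)
  have hpart : ∀ n m, m < n + K + 1 → p m * s n ^ m ≤ 2 * (l * s n) := fun n m hm => by
    have h1 := Finset.single_le_sum (f := fun m => p m * s n ^ m) (fun m _ => hterm n m)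
      (Finset.mem_range.2 hm)
    have h2 : 0 ≤ ∑ m ∈ Finset.range (n + K + 1), p m * s n ^ m :=
      Finset.sum_nonneg fun m _ => hterm n m
    have h3 := hle n
    have h4 := hhalf n
    nlinarith
  have hlow : ∀ n, p 0 ≤ 2 * (l * s n) := fun n => by
    simpa using hpart n 0 (by omega)
  have hl0 : 0 < l := by
    by_contra! h
    have := mul_nonpos_of_nonpos_of_nonneg h (hs 0).le
    linarith [hlow 0]
  -- The term `m = 0` keeps `s n` away from `0`. The term `m = K` bounds it above, as `K ≥ 2` makes
  -- `p K * s ^ K` outgrow `2 * l * s`.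
  have hmem : ∀ n, s n ∈ Set.Icc (p 0 / (2 * l)) (max 1 (2 * l / p K)) := fun n => by
    constructor
    · rw [div_le_iff₀ (by positivity)]
      linarith [hlow n]
    · rw [le_max_iff]
      rcases le_total (s n) 1 with h1 | h1
      · exact Or.inl h1
      · right
        rw [le_div_iff₀ hpK]
        have h2 : s n ^ 2 ≤ s n ^ K := pow_le_pow_right₀ h1 hK
        have h3 := mul_le_mul_of_nonneg_left h2 hpK.le
        have h4 := hpart n K (by omega)
        have h5 := hs n
        by_contra! h6
        nlinarith
  obtain ⟨t, ht, φ, hφ, hlim⟩ := isCompact_Icc.tendsto_subseq hmem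
  have ht0 : 0 < t := lt_of_lt_of_le (by positivity) ht.1
  have hbound : ∀ M : ℕ, ∑ m ∈ Finset.range M, p m * t ^ m ≤ l * t := fun M => by
    have h1 : Tendsto (fun n => (1 - 1 / ((φ n : ℝ) + 2)) *
        ∑ m ∈ Finset.range M, p m * s (φ n) ^ m) atTop
        (𝓝 ((1 - 0) * ∑ m ∈ Finset.range M, p m * t ^ m)) := by
      refine Tendsto.mul (tendsto_const_nhds.sub ?_)
        (tendsto_finsetSum _ fun m _ => (hlim.pow m).const_mul (p m))
      have h2 : Tendsto (fun n : ℕ => (1 : ℝ) / ((n : ℝ) + 2)) atTop (𝓝 0) := by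
        have h3 : Tendsto (fun n : ℕ => (n : ℝ) + 2) atTop atTop :=
          tendsto_atTop_add_const_right _ _ tendsto_natCast_atTop_atTop
        simp only [one_div]
        exact h3.inv_tendsto_atTop
      exact h2.comp hφ.tendsto_atTop
    rw [sub_zero, one_mul] at h1
    refine le_of_tendsto_of_tendsto h1 (hlim.const_mul l) ?_
    filter_upwards [eventually_ge_atTop M] with n hn
    refine le_trans (mul_le_mul_of_nonneg_left ?_ ?_) (hle (φ n))
    · refine Finset.sum_le_sum_of_subset_of_nonneg ?_ fun m _ _ => hterm _ m
      have := hφ.id_le n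
      simp only [id] at this
      exact Finset.range_subset_range.2 (by omega)
    · linarith [hhalf (φ n)]
  have hnn : ∀ m, 0 ≤ p m * t ^ m := fun m => mul_nonneg (hp m) (by positivity)
  refine ⟨t, ht0, summable_of_sum_range_le hnn hbound, ?_⟩
  rw [div_le_iff₀ ht0]
  exact Real.tsum_le_of_sum_range_le hnn hbound

lemma tendsto_alphaA (hp : ∀ k, 0 ≤ p k) (hp0 : 0 < p 0) {K : ℕ} (hK : 2 ≤ K)
    (hpK : 0 < p K) {L : ℝ} (hle : ∀ k, 1 ≤ k → alphaA p k ≤ L)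
    (hL : ∀ s, 0 < s → (Summable fun k => p k * s ^ k) → L ≤ pgf p s / s) :
    Tendsto (alphaA p) atTop (𝓝 L) := by
  -- The shift by one leaves out the empty matrix `k = 0`.
  have hmono : Monotone fun n => alphaA p (n + 1) :=
    monotone_nat_of_le_succ fun n => alphaA_le_succ hp (by omega)
  have hbdd : BddAbove (Set.range fun n => alphaA p (n + 1)) := by
    refine ⟨L, ?_⟩
    rintro _ ⟨n, rfl⟩
    exact hle _ (by omega)
  obtain ⟨s, hs, hss, h⟩ := exists_pgf_div_le hp hp0 hK hpK
    (l := ⨆ n, alphaA p (n + 1)) fun k hk => by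
      obtain ⟨n, rfl⟩ := Nat.exists_eq_add_of_le' hk
      exact le_ciSup hbdd n
  have heq : ⨆ n, alphaA p (n + 1) = L :=
    le_antisymm (ciSup_le fun n => hle _ (by omega)) ((hL s hs hss).trans h)
  rw [← tendsto_add_atTop_iff_nat 1, ← heq]
  exact tendsto_atTop_ciSup hmono hbdd

end Truncation

/-! ### The operator on `ℓ^q`: boundedness and non-compactness. -/

section SequenceSpace

variable {q : ℝ≥0∞}

/-- Each entry of `x` is used at most once in `y`, so no `ℓ^q` bound can grow. The cases `q = ∞` and
`q < ∞` are stated in the form in which `lp` norms are bounded. -/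
lemma memℓp_and_norm_le_of_injOn {x y : ℕ → ℝ} (hx : Memℓp x q) {σ : ℕ → ℕ} {S : Set ℕ}
    (hσ : Set.InjOn σ S) (hy : ∀ i ∈ S, y i = x (σ i)) (hy0 : ∀ i ∉ S, y i = 0) (hq : 1 ≤ q) :
    Memℓp y q ∧ ∀ C : ℝ, 0 ≤ C → (q = ∞ → ∀ i, ‖x i‖ ≤ C) →
      (q ≠ ∞ → ∑' i, ‖x i‖ ^ q.toReal ≤ C ^ q.toReal) →
      (q = ∞ → ∀ i, ‖y i‖ ≤ C) ∧ (q ≠ ∞ → ∑' i, ‖y i‖ ^ q.toReal ≤ C ^ q.toReal) := by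
  by_cases hqt : q = ∞
  · subst hqt
    have hb : ∀ C : ℝ, 0 ≤ C → (∀ i, ‖x i‖ ≤ C) → ∀ i, ‖y i‖ ≤ C := fun C hC h i => by
      by_cases hi : i ∈ S
      · rw [hy i hi]; exact h _
      · rw [hy0 i hi, norm_zero]; exact hC
    refine ⟨?_, fun C hC h1 _ => ⟨fun _ => hb C hC (h1 rfl), fun h => absurd rfl h⟩⟩
    obtain ⟨C, hC⟩ := memℓp_infty_iff.1 hx
    refine memℓp_infty ⟨C, ?_⟩
    rintro _ ⟨i, rfl⟩
    exact hb C ((norm_nonneg _).trans (hC ⟨0, rfl⟩)) (fun i => hC ⟨i, rfl⟩) i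
  · have hq0 : 0 < q.toReal :=
      ENNReal.toReal_pos (zero_lt_one.trans_le hq).ne' hqt
    have hxs := (memℓp_gen_iff hq0).1 hx
    have hinj : Function.Injective fun i : S => σ i := fun a b h => Subtype.ext (hσ a.2 b.2 h)
    have hys : Summable fun i : S => ‖y i‖ ^ q.toReal :=
      (hxs.comp_injective hinj).congr fun i => by
        rw [Function.comp_apply, hy i i.2]
    have hsupp : Function.support (fun i => ‖y i‖ ^ q.toReal) ⊆ S := fun i hi => by
      by_contra h
      exact hi (by simp [hy0 i h, hq0.ne'])
    have hind : S.indicator (fun i => ‖y i‖ ^ q.toReal) = fun i => ‖y i‖ ^ q.toReal :=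
      Set.indicator_eq_self.2 hsupp
    have hysum : Summable fun i => ‖y i‖ ^ q.toReal := by
      rw [← hind]; exact summable_subtype_iff_indicator.1 hys
    refine ⟨memℓp_gen hysum, fun C _ _ h2 => ⟨fun h => absurd h hqt, fun _ => ?_⟩⟩
    refine le_trans ?_ (h2 hqt)
    rw [← hind, ← tsum_subtype]
    have h3 : ∀ i : S, ‖y i‖ ^ q.toReal = ‖x (σ i)‖ ^ q.toReal := fun i => by rw [hy i i.2]
    rw [tsum_congr h3]
    exact (hys.congr h3).tsum_le_tsum_of_inj (g := fun i => ‖x i‖ ^ q.toReal) (fun i : S => σ i)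
      hinj (fun c _ => by positivity) (fun i => le_rfl) hxs

/-- The operator `(S_m x)_i = x_{i - 1 + m}` for `i ≥ 1`, `(S_m x)_0 = 0`. -/
noncomputable def partialShift (q : ℝ≥0∞) [hq : Fact (1 ≤ q)] (m : ℕ) :
    lp (fun _ : ℕ => ℝ) q →L[ℝ] lp (fun _ : ℕ => ℝ) q :=
  LinearMap.mkContinuous
    { toFun := fun x => ⟨fun i => if 1 ≤ i then x (i - 1 + m) else 0,
        (memℓp_and_norm_le_of_injOn (lp.memℓp x) (σ := fun i => i - 1 + m)
          (S := {i | 1 ≤ i}) (fun a ha b hb h => by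
            simp only [Set.mem_ofPred_eq] at ha hb h; omega)
          (fun i hi => if_pos hi) (fun i hi => if_neg hi) hq.out).1⟩
      map_add' := fun x y => by
        ext i
        change (if 1 ≤ i then x (i - 1 + m) + y (i - 1 + m) else 0) =
          (if 1 ≤ i then x (i - 1 + m) else 0) + (if 1 ≤ i then y (i - 1 + m) else 0)
        split_ifs <;> simp
      map_smul' := fun c x => by
        ext i
        by_cases hi : 1 ≤ i <;> simp [hi] }
    1 fun x => by
      rw [one_mul]
      have key := (memℓp_and_norm_le_of_injOn
          (y := fun i => if 1 ≤ i then x (i - 1 + m) else 0) (lp.memℓp x)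
          (σ := fun i => i - 1 + m) (S := {i | 1 ≤ i}) (fun a ha b hb h => by
            simp only [Set.mem_ofPred_eq] at ha hb h; omega)
          (fun i hi => if_pos hi) (fun i hi => if_neg hi) hq.out).2 ‖x‖ (norm_nonneg _)
          (fun _ => lp.norm_apply_le_norm (zero_lt_one.trans_le hq.out).ne' x)
          (fun h => (lp.norm_rpow_eq_tsum
            (ENNReal.toReal_pos (zero_lt_one.trans_le hq.out).ne' h) x).ge)
      by_cases h : q = ∞
      · subst h
        exact lp.norm_le_of_forall_le (norm_nonneg _) (key.1 rfl)
      · exact lp.norm_le_of_tsum_le (ENNReal.toReal_pos (zero_lt_one.trans_le hq.out).ne' h)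
          (norm_nonneg _) (key.2 h)

variable [hq : Fact (1 ≤ q)]

lemma norm_partialShift_le (m : ℕ) : ‖partialShift q m‖ ≤ 1 :=
  LinearMap.mkContinuous_norm_le _ zero_le_one _

variable {p : ℕ → ℝ}

/-- The operator is `∑ pₘ Sₘ`, absolutely convergent in operator norm since `‖Sₘ‖ ≤ 1`. -/
lemma exists_isGivenByA (hp : Summable p) (q : ℝ≥0∞) [Fact (1 ≤ q)] :
    ∃ T : lp (fun _ : ℕ => ℝ) q →L[ℝ] lp (fun _ : ℕ => ℝ) q, IsGivenByA p q T := by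
  have hs : Summable fun m => p m • partialShift q m := by
    refine Summable.of_norm_bounded hp.abs fun m => ?_
    rw [norm_smul]
    exact mul_le_of_le_one_right (norm_nonneg _) (norm_partialShift_le m)
  refine ⟨∑' m, p m • partialShift q m, fun x i => ?_⟩
  have h1 := (hs.hasSum.mapL (ContinuousLinearMap.apply ℝ (lp (fun _ : ℕ => ℝ) q) x)).mapL
    (lp.evalCLM ℝ (fun _ : ℕ => ℝ) q i)
  have h2 : HasSum (fun m => p m * (if 1 ≤ i then x (i - 1 + m) else 0))
      ((∑' m, p m • partialShift q m) x i) := h1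
  by_cases hi : 1 ≤ i
  · simp only [hi, if_true] at h2
    have hinj : Function.Injective fun m => i - 1 + m := fun a b h => by
      simpa using h
    refine (hinj.hasSum_iff fun j hj => ?_).1 (h2.congr_fun fun m => ?_)
    · have : ¬ i ≤ j + 1 := fun h => hj ⟨j + 1 - i, by simp only; omega⟩
      simp [matA, this]
    · have h3 : i ≤ i - 1 + m + 1 := by omega
      have h4 : i - 1 + m + 1 - i = m := by omega
      simp [matA, hi, h3, h4]
  · simpa [matA, hi] using h2

/-- For `n < n'`, coordinate `n' + 1` is `p₀` in `A e_{n'}` and `0` in `A e_n`, so `(A e_n)` has no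
Cauchy subsequence. -/
lemma not_isCompactOperator_of_isGivenByA (hp0 : 0 < p 0)
    {T : lp (fun _ : ℕ => ℝ) q →L[ℝ] lp (fun _ : ℕ => ℝ) q} (hT : IsGivenByA p q T) :
    ¬ IsCompactOperator T := by
  intro hc
  have hq0 : 0 < q := zero_lt_one.trans_le hq.out
  set e : ℕ → lp (fun _ : ℕ => ℝ) q := fun n => lp.single q n (1 : ℝ) with he
  have hTe : ∀ n i, T (e n) i = matA p i n := fun n i => by
    refine (hT (e n) i).unique ?_
    have := hasSum_single (f := fun j => matA p i j * e n j) n fun j hj => by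
      rw [he]; simp only; rw [lp.single_apply_ne q n _ hj, mul_zero]
    simpa [he, lp.single_apply_self] using this
  obtain ⟨C, hC, hsub⟩ := hc.image_closedBall_subset_compact (f := T.toLinearMap) 1
  have hmem : ∀ n, T (e n) ∈ C := fun n => hsub ⟨e n, by
    rw [mem_closedBall_zero_iff, he]
    simp only
    rw [lp.norm_single hq0, norm_one], rfl⟩
  obtain ⟨y, -, φ, hφ, hlim⟩ := hC.tendsto_subseq hmem
  obtain ⟨N, hN⟩ := Metric.cauchySeq_iff'.1 hlim.cauchySeq (p 0) hp0
  have h1 := hN (N + 1) (by omega)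
  have hlt : φ N < φ (N + 1) := hφ (by omega)
  have h2 := lp.norm_apply_le_norm hq0.ne' (T (e (φ (N + 1))) - T (e (φ N))) (φ (N + 1) + 1)
  rw [lp.coeFn_sub, Pi.sub_apply, hTe, hTe] at h2
  have h3 : ¬ φ (N + 1) ≤ φ N := by omega
  simp only [matA, le_add_iff_nonneg_left, zero_le, le_refl, and_self, if_true, Nat.sub_self,
    add_le_add_iff_right, h3, and_false, if_false, sub_zero, Real.norm_of_nonneg hp0.le] at h2
  rw [dist_eq_norm] at h1
  exact absurd (h2.trans_lt h1) (lt_irrefl _)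

end SequenceSpace

/-! ### Assembly of the theorem. -/

lemma exists_two_le_pos {p : ℕ → ℝ} (hp : ∀ k, 0 ≤ p k) (hp_sum : HasSum p 1)
    (hp01 : p 0 + p 1 < 1) : ∃ K, 2 ≤ K ∧ 0 < p K := by
  by_contra! h
  have h1 : HasSum p (∑ k ∈ Finset.range 2, p k) := hasSum_sum_of_ne_finset_zero fun k hk =>
    le_antisymm (h k (by simp only [Finset.mem_range] at hk; omega)) (hp k)
  have h2 := h1.unique hp_sum
  rw [Finset.sum_range_succ, Finset.sum_range_one] at h2
  linarith

theorem proposition4p9 (p : ℕ → ℝ)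
    -- `p` is a probability mass function on `{0, 1, 2, …}` with finite mean
    (hp_nonneg : ∀ k, 0 ≤ p k) (hp_sum : HasSum p 1)
    (hp_mean : Summable fun k : ℕ => (k : ℝ) * p k)
    (hp0_pos : 0 < p 0) (hp0_lt : p 0 < 1) (hp01 : p 0 + p 1 < 1)
    -- aperiodicity: `gcd {j : p_j > 0} = 1`
    (hp_gcd : ∀ d : ℕ, (∀ j, 0 < p j → d ∣ j) → d = 1) :
    -- the limit defining `R` exists and is positive
    (Tendsto (fun s => s / pgf p s) (𝓝[<] (criticalPoint p)) (𝓝 (decayR p)) ∧ 0 < decayR p) ∧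
    -- `α_k` is the Perron-Frobenius eigenvalue of `A_k`, positive once `k ≥ k₀`
    (∀ k, 1 ≤ k → IsPerronEigenvalue (truncA p k) (alphaA p k)) ∧
    (∀ k, kZero p ≤ k → 0 < alphaA p k) ∧
    -- `α_k ↑ 1 / R`
    MonotoneOn (alphaA p) (Set.Ici 1) ∧
    Tendsto (alphaA p) atTop (𝓝 (1 / decayR p)) ∧
    -- `A` is a bounded operator on every `ℓ^q`, `1 ≤ q ≤ ∞`, and it is not compact
    (∀ (q : ℝ≥0∞) [Fact (1 ≤ q)],
      ∃ T : lp (fun _ : ℕ => ℝ) q →L[ℝ] lp (fun _ : ℕ => ℝ) q,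
        IsGivenByA p q T ∧ ¬ IsCompactOperator T) := by
  obtain ⟨K, hK, hpK⟩ := exists_two_le_pos hp_nonneg hp_sum hp01
  obtain ⟨L, hL, hlim, hlow, hev⟩ :=
    exists_tendsto_pgf_div hp_nonneg hp0_pos hp_sum.summable hK hpK
  have hlim' : Tendsto (fun s => s / pgf p s) (𝓝[<] (criticalPoint p)) (𝓝 L⁻¹) := by
    simpa only [inv_div] using hlim.inv₀ hL.ne'
  have hR : decayR p = L⁻¹ := hlim'.limUnder_eq
  have hle : ∀ k, 1 ≤ k → alphaA p k ≤ L := fun k hk => by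
    refine ge_of_tendsto hlim ?_
    filter_upwards [hev] with s hs
    exact alphaA_le hp_nonneg hk hs.1 (summable_pgf_of_lt_radius hs.1.le hs.2).1
  have hk0 : kZero p ∈ {k : ℕ | 1 ≤ k ∧ 0 < p k} := Nat.sInf_mem ⟨K, by omega, hpK⟩
  refine ⟨⟨by rwa [hR], by rw [hR]; exact inv_pos.2 hL⟩,
    fun k hk => (maxEigenvalue_spec hk (truncA_nonneg hp_nonneg)).2.1,
    fun k hk => alphaA_pos hp_nonneg hp0_pos hk0.1 hk0.2 hk, alphaA_mono hp_nonneg, ?_,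
    fun q _ => ?_⟩
  · rw [hR, one_div, inv_inv]
    exact tendsto_alphaA hp_nonneg hp0_pos hK hpK hle hlow
  · obtain ⟨T, hT⟩ := exists_isGivenByA hp_sum.summable q
    exact ⟨T, hT, not_isCompactOperator_of_isGivenByA hp0_pos hT⟩
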